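/- Let $N,d\ge 1$ be integers and let $S_0,\dots,S_d$ be complex $N\times N$ matrices. A solution of the truncated matrix trigonometric moment problem with moments $S_0,\dots,S_d$ is a non-decreasing function $M=(m_{k,l})_{k,l=0}^{N-1}:[0,2\pi]\to\mathbb{C}^{N\times N}$ (i.e. $M(t)-M(s)\ge 0$ for $s\le t$), left-continuous on $(0,2\pi]$, with $M(0)=0$ and $\int_0^{2\pi}e^{int}\,dM(t)=S_n$ for $n=0,\dots,d$. The problem is indeterminate if it has more than one solution. Put $S_{-k}=S_k^*$ for $1\le k\le d$, and assume that the block Toeplitz matrix $T_d=(S_{i-j})_{i,j=0}^d=(\gamma_{n,m})_{n,m=0}^{(d+1)N-1}$ is positive semidefinite. Let $H$ be the Hilbert space obtained from $\mathbb{C}^{(d+1)N}$ with the form $B(u,w)=\sum_{n,r}u_n\overline{w_r}\gamma_{n,r}$ by identifying $u$ and $w$ whenever $B(u-w,u-w)=0$. Let $x_n\in H$ be the class of the $n$-th standard basis vector, so that $(x_n,x_m)_H=\gamma_{n,m}$, and let $A$ be the (well-defined, isometric) operator with domain $\operatorname{Lin}\{x_0,\dots,x_{dN-1}\}$ given by $A\sum_{k=0}^{dN-1}\alpha_kx_k=\sum_{k=0}^{dN-1}\alpha_kx_{k+N}$.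 A spectral measure of $A$ is an operator-valued function $\mathbf E$ on the Borel sets of the unit circle $\mathbb{T}$ of the form $\mathbf E(\delta)=P_H\widetilde E(\delta)|_H$, where $\widetilde E$ is the orthogonal (projection-valued) spectral measure of a unitary operator $\widetilde U\supseteq A$ in a Hilbert space $\widetilde H\supseteq H$. It corresponds to a solution $M$ if $$M(t)=\big((\mathbf E(\delta_t)x_k,x_j)_H\big)_{k,j=0}^{N-1},\qquad \delta_t=\{e^{i\tau}:0\le\tau<t\},\quad 0\le t<2\pi.$$ Suppose that the moment problem is indeterminate. Let $M$ be a solution, let $\mathbf E$ be the spectral measure of $A$ corresponding to $M$, and define $M_{\mathbb T}(\delta)=\big((\mathbf E(\delta)x_k,x_j)_H\big)_{k,j=0}^{N-1}$ for Borel sets $\delta\subseteq\mathbb{T}$. Then for every Borel set $\Delta\subseteq\mathbb{T}$, $$M_{\mathbb T}(\Delta)=0\iff \mathbf E(\Delta)=0.$$ -/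

import Mathlib

open MeasureTheory Set Matrix
open scoped ComplexOrder Function

universe v

/-- The Borel `σ`-algebra `𝔅(𝕋)` of the unit circle `𝕋`. -/
noncomputable instance Circle.instMeasurableSpaceBorel : MeasurableSpace Circle := borel Circle

instance Circle.instBorelSpaceBorel : BorelSpace Circle := ⟨rfl⟩

namespace TruncatedMoment

noncomputable section

/-! ## The truncated matrix trigonometric moment problem -/

/-- `HasStieltjesIntegral f g a b I` says that the Riemann-Stieltjes integral `∫_a^b f(t) dg(t)`
exists and equals `I`: the sums `∑ f(ξ_i) (g(t_{i+1}) - g(t_i))` over the tagged partitions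
`a = t_0 ≤ ξ_0 ≤ t_1 ≤ ... ≤ t_n = b` converge to `I` as the mesh of the partition tends to `0`. -/
def HasStieltjesIntegral (f g : ℝ → ℂ) (a b : ℝ) (I : ℂ) : Prop :=
  ∀ ε : ℝ, 0 < ε → ∃ η : ℝ, 0 < η ∧
    ∀ (n : ℕ) (t ξ : ℕ → ℝ), t 0 = a → t n = b →
      (∀ i < n, t i ≤ ξ i ∧ ξ i ≤ t (i + 1) ∧ t (i + 1) - t i < η) →
      ‖(∑ i ∈ Finset.range n, f (ξ i) * (g (t (i + 1)) - g (t i))) - I‖ < ε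

variable {N d : ℕ}

/-- `M : [0, 2π] → ℂ_{N×N}` is a solution of the moment problem with moments `S_0, ..., S_d`.
Only the values of `M` on `[0, 2π]` matter. -/
structure IsSolution (S : Fin (d + 1) → Matrix (Fin N) (Fin N) ℂ)
    (M : ℝ → Matrix (Fin N) (Fin N) ℂ) : Prop where
  zero : M 0 = 0
  mono : ∀ s t : ℝ, 0 ≤ s → s ≤ t → t ≤ 2 * Real.pi → (M t - M s).PosSemidef
  left_continuous : ∀ t : ℝ, 0 < t → t ≤ 2 * Real.pi → ContinuousWithinAt M (Icc 0 t) t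
  moments : ∀ (n : Fin (d + 1)) (k l : Fin N),
    HasStieltjesIntegral (fun t => Complex.exp (Complex.I * (n : ℕ) * t)) (fun t => M t k l)
      0 (2 * Real.pi) (S n k l)

/-- The moment problem is indeterminate: it is solvable and its solution, as a function on
`[0, 2π]`, is not unique. -/
def IsIndeterminate (S : Fin (d + 1) → Matrix (Fin N) (Fin N) ℂ) : Prop :=
  ∃ M₁ M₂ : ℝ → Matrix (Fin N) (Fin N) ℂ, IsSolution S M₁ ∧ IsSolution S M₂ ∧
    ¬ EqOn M₁ M₂ (Icc 0 (2 * Real.pi))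

/-- The block `S_{i-j}`, where `S_{-k} = S_k^*` for `1 ≤ k ≤ d`. -/
def momentBlock (S : Fin (d + 1) → Matrix (Fin N) (Fin N) ℂ) (i j : Fin (d + 1)) :
    Matrix (Fin N) (Fin N) ℂ :=
  if j ≤ i then S ⟨(i : ℕ) - j, by omega⟩ else (S ⟨(j : ℕ) - i, by omega⟩)ᴴ

/-- The block Toeplitz matrix `T_d = (S_{i-j})_{i,j=0}^d = (γ_{n,m})`. The scalar index
`n = kN + s`, with `0 ≤ k ≤ d` and `0 ≤ s < N`, is written as the pair `(k, s)`. -/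
def toeplitz (S : Fin (d + 1) → Matrix (Fin N) (Fin N) ℂ) :
    Matrix (Fin (d + 1) × Fin N) (Fin (d + 1) × Fin N) ℂ :=
  fun p q => momentBlock S p.1 q.1 p.2 q.2

/-! ## The Hilbert space `H` and the isometric operator `A` -/

/-- The space `𝔥` of vectors of length `(d+1)N`, to be equipped with the form `B`. -/
def QuasiSpace {S : Fin (d + 1) → Matrix (Fin N) (Fin N) ℂ} (_ : (toeplitz S).PosSemidef) : Type :=
  Fin (d + 1) × Fin N → ℂ

variable {S : Fin (d + 1) → Matrix (Fin N) (Fin N) ℂ}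

instance (hT : (toeplitz S).PosSemidef) : AddCommGroup (QuasiSpace hT) :=
  inferInstanceAs (AddCommGroup (Fin (d + 1) × Fin N → ℂ))

instance (hT : (toeplitz S).PosSemidef) : Module ℂ (QuasiSpace hT) :=
  inferInstanceAs (Module ℂ (Fin (d + 1) × Fin N → ℂ))

instance (hT : (toeplitz S).PosSemidef) : FiniteDimensional ℂ (QuasiSpace hT) :=
  inferInstanceAs (FiniteDimensional ℂ (Fin (d + 1) × Fin N → ℂ))

/-- The form `B(u, w) = ∑_{n,r} u_n \overline{w_r} γ_{n,r}`. -/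
def form (S : Fin (d + 1) → Matrix (Fin N) (Fin N) ℂ) (u w : Fin (d + 1) × Fin N → ℂ) : ℂ :=
  ∑ n, ∑ r, u n * star (w r) * toeplitz S n r

/-- `𝔥` with `B` is a pre-Hilbert space. Mathlib's inner product is conjugate linear in its *first*
argument, so `B(u, w)` is `inner ℂ w u`. -/
instance core (hT : (toeplitz S).PosSemidef) : PreInnerProductSpace.Core ℂ (QuasiSpace hT) where
  inner w u := form S u w
  conj_inner_symm x y := by
    simp only [form, map_sum, map_mul, starRingEnd_apply, star_star]
    rw [Finset.sum_comm]
    refine Finset.sum_congr rfl fun n _ => Finset.sum_congr rfl fun r _ => ?_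
    rw [hT.1.apply]
    ring
  re_inner_nonneg x := by
    have h := (Complex.nonneg_iff.1 (hT.dotProduct_mulVec_nonneg (star x))).1
    have e : form S x x = star (star x) ⬝ᵥ (toeplitz S *ᵥ star x) := by
      simp only [form, dotProduct, mulVec, Finset.mul_sum]
      refine Finset.sum_congr rfl fun n _ => Finset.sum_congr rfl fun r _ => ?_
      change x n * star (x r) * toeplitz S n r = star (star (x n)) * (toeplitz S n r * star (x r))
      rw [star_star]
      ring
    change 0 ≤ (form S x x).re
    rw [e]
    exact h
  add_left x y z := by
    change form S z (fun i => x i + y i) = form S z x + form S z y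
    simp only [form, star_add, mul_add, add_mul, Finset.sum_add_distrib]
  smul_left x y r := by
    change form S y (fun i => r * x i) = starRingEnd ℂ r * form S y x
    simp only [form, star_mul', Finset.mul_sum, starRingEnd_apply]
    refine Finset.sum_congr rfl fun n _ => Finset.sum_congr rfl fun r _ => ?_
    ring

instance (hT : (toeplitz S).PosSemidef) : SeminormedAddCommGroup (QuasiSpace hT) :=
  InnerProductSpace.Core.toSeminormedAddCommGroup (𝕜 := ℂ)

instance (hT : (toeplitz S).PosSemidef) : InnerProductSpace ℂ (QuasiSpace hT) :=
  InnerProductSpace.ofCore (core hT)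

/-- The Hilbert space `H` of the classes `[u]`, where `[u] = [w]` iff `B(u - w, u - w) = 0`. -/
abbrev MomentSpace (hT : (toeplitz S).PosSemidef) : Type := SeparationQuotient (QuasiSpace hT)

instance (hT : (toeplitz S).PosSemidef) : FiniteDimensional ℂ (MomentSpace hT) :=
  Module.Finite.of_surjective (SeparationQuotient.mkCLM ℂ (QuasiSpace hT)).toLinearMap
    SeparationQuotient.surjective_mk

instance (hT : (toeplitz S).PosSemidef) : CompleteSpace (MomentSpace hT) :=
  FiniteDimensional.complete ℂ (MomentSpace hT)

/-- The class `[u]` of `u`. -/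
def cls (hT : (toeplitz S).PosSemidef) (u : Fin (d + 1) × Fin N → ℂ) : MomentSpace hT :=
  SeparationQuotient.mkCLM ℂ (QuasiSpace hT) u

/-- The vectors `x_n = [ε_n]`, with `n = kN + s` written as `(k, s)`. -/
def momentVec (hT : (toeplitz S).PosSemidef) (p : Fin (d + 1) × Fin N) : MomentSpace hT :=
  cls hT (Pi.single p 1)

theorem cls_eq_sum (hT : (toeplitz S).PosSemidef) (u : Fin (d + 1) × Fin N → ℂ) :
    cls hT u = ∑ p, u p • momentVec hT p := by
  let L : (Fin (d + 1) × Fin N → ℂ) →ₗ[ℂ] MomentSpace hT :=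
    (SeparationQuotient.mkCLM ℂ (QuasiSpace hT)).toLinearMap
  have h := LinearMap.pi_apply_eq_sum_univ L u
  have e : ∀ p : Fin (d + 1) × Fin N,
      (fun j => if p = j then (1 : ℂ) else 0) = Pi.single p 1 := by
    intro p
    funext j
    simp [Pi.single_apply, eq_comm]
  simp only [e] at h
  exact h

theorem inner_cls (hT : (toeplitz S).PosSemidef) (u w : Fin (d + 1) × Fin N → ℂ) :
    inner ℂ (cls hT w) (cls hT u) = form S u w := rfl

/-- `(x_n, x_m)_H = γ_{n,m}`. -/
theorem inner_vec (hT : (toeplitz S).PosSemidef) (p q : Fin (d + 1) × Fin N) :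
    inner ℂ (momentVec hT q) (momentVec hT p) = toeplitz S p q := by
  rw [momentVec, momentVec, inner_cls, form, Finset.sum_eq_single p, Finset.sum_eq_single q]
  · simp
  · intro r _ h
    simp [Pi.single_eq_of_ne h]
  · simp
  · intro n _ h
    simp [Pi.single_eq_of_ne h]
  · simp

/-- The shifted pairs `(x_k, x_{k+N})`, `0 ≤ k < dN`, span the graph of `A`. -/
def shiftGraph (hT : (toeplitz S).PosSemidef) : Submodule ℂ (MomentSpace hT × MomentSpace hT) :=
  Submodule.span ℂ (range fun p : Fin d × Fin N =>
    (momentVec hT (p.1.castSucc, p.2), momentVec hT (p.1.succ, p.2)))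

theorem inner_vec_succ (hT : (toeplitz S).PosSemidef) (p q : Fin d × Fin N) :
    inner ℂ (momentVec hT (p.1.succ, p.2)) (momentVec hT (q.1.succ, q.2)) =
      inner ℂ (momentVec hT (p.1.castSucc, p.2)) (momentVec hT (q.1.castSucc, q.2)) := by
  simp [inner_vec, toeplitz, momentBlock]

theorem inner_shiftGraph (hT : (toeplitz S).PosSemidef) (y z : MomentSpace hT × MomentSpace hT)
    (hy : y ∈ shiftGraph hT) (hz : z ∈ shiftGraph hT) :
    inner ℂ y.2 z.2 = inner ℂ y.1 z.1 := by
  induction hy using Submodule.span_induction with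
  | mem y hy =>
    obtain ⟨p, rfl⟩ := hy
    induction hz using Submodule.span_induction with
    | mem z hz => obtain ⟨q, rfl⟩ := hz; exact inner_vec_succ hT p q
    | zero => simp
    | add a b _ _ ha hb => simp only [Prod.fst_add, Prod.snd_add, inner_add_right, ha, hb]
    | smul c a _ ha => simp only [Prod.smul_fst, Prod.smul_snd, inner_smul_right, ha]
  | zero => simp
  | add a b _ _ ha hb => simp only [Prod.fst_add, Prod.snd_add, inner_add_left, ha, hb]
  | smul c a _ ha => simp only [Prod.smul_fst, Prod.smul_snd, inner_smul_left, ha]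

/-- The operator `A (∑_{k<dN} α_k x_k) = ∑_{k<dN} α_k x_{k+N}`, with domain
`D(A) = Lin {x_k : 0 ≤ k < dN}`. It is well defined by `shiftOperator_graph`. -/
def shiftOperator (hT : (toeplitz S).PosSemidef) : MomentSpace hT →ₗ.[ℂ] MomentSpace hT :=
  (shiftGraph hT).toLinearPMap

theorem shiftOperator_graph (hT : (toeplitz S).PosSemidef) :
    (shiftOperator hT).graph = shiftGraph hT := by
  refine Submodule.toLinearPMap_graph_eq _ fun y hy h0 => ?_
  rw [← inner_self_eq_zero (𝕜 := ℂ), inner_shiftGraph hT y y hy hy, h0, inner_zero_left]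

theorem shiftOperator_domain (hT : (toeplitz S).PosSemidef) :
    (shiftOperator hT).domain =
      Submodule.span ℂ (range fun p : Fin d × Fin N => momentVec hT (p.1.castSucc, p.2)) := by
  rw [shiftOperator, Submodule.toLinearPMap_domain, shiftGraph, Submodule.map_span, ← range_comp]
  rfl

theorem shiftOperator_apply (hT : (toeplitz S).PosSemidef) (α : Fin d × Fin N → ℂ)
    (x : (shiftOperator hT).domain)
    (hx : (x : MomentSpace hT) = ∑ p, α p • momentVec hT (p.1.castSucc, p.2)) :
    shiftOperator hT x = ∑ p, α p • momentVec hT (p.1.succ, p.2) := by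
  have h : (∑ p, α p • momentVec hT (p.1.castSucc, p.2), ∑ p, α p • momentVec hT (p.1.succ, p.2)) ∈
      (shiftOperator hT).graph := by
    rw [shiftOperator_graph, show (∑ p, α p • momentVec hT (p.1.castSucc, p.2),
      ∑ p, α p • momentVec hT (p.1.succ, p.2)) = ∑ p : Fin d × Fin N,
        α p • (momentVec hT (p.1.castSucc, p.2), momentVec hT (p.1.succ, p.2)) by
      simp [Prod.ext_iff, Prod.fst_sum, Prod.snd_sum]]
    exact Submodule.sum_mem _ fun p _ => Submodule.smul_mem _ _ (Submodule.subset_span ⟨p, rfl⟩)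
  obtain ⟨y, hy, hy'⟩ := LinearPMap.mem_graph_iff _ |>.1 h
  have : x = y := Subtype.ext (hx.trans hy.symm)
  rw [this, hy']

/-! ## Spectral measures -/

/-- An orthogonal spectral measure (projection-valued measure) on `𝔅(𝕋)` in the Hilbert space `K`.
Only the values on Borel sets matter. -/
structure OrthogonalSpectralMeasure (K : Type*) [NormedAddCommGroup K] [InnerProductSpace ℂ K]
    [CompleteSpace K] where
  toFun : Set Circle → (K →L[ℂ] K)
  isStarProjection' : ∀ s, MeasurableSet s → IsStarProjection (toFun s)
  univ' : toFun univ = 1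
  inter' : ∀ s t, MeasurableSet s → MeasurableSet t → toFun (s ∩ t) = toFun s * toFun t
  iUnion' : ∀ f : ℕ → Set Circle, (∀ i, MeasurableSet (f i)) → Pairwise (Disjoint on f) →
    ∀ x : K, HasSum (fun i => toFun (f i) x) (toFun (⋃ i, f i) x)

namespace OrthogonalSpectralMeasure

variable {K : Type*} [NormedAddCommGroup K] [InnerProductSpace ℂ K] [CompleteSpace K]

theorem inner_eq (F : OrthogonalSpectralMeasure K) (x : K) {s : Set Circle}
    (hs : MeasurableSet s) : inner ℂ x (F.toFun s x) = ((‖F.toFun s x‖ ^ 2 : ℝ) : ℂ) := by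
  have h := F.isStarProjection' s hs
  have h1 : F.toFun s x = F.toFun s (F.toFun s x) :=
    congrArg (fun T : K →L[ℂ] K => T x) h.isIdempotentElem.eq.symm
  have h2 := ContinuousLinearMap.adjoint_inner_left (F.toFun s) (F.toFun s x) x
  rw [← ContinuousLinearMap.star_eq_adjoint, h.isSelfAdjoint.star_eq] at h2
  rw [h1, ← h2, inner_self_eq_norm_sq_to_K, ← h1]
  norm_cast

/-- The finite positive measure `s ↦ (F(s) x, x)`. -/
def scalarMeasure (F : OrthogonalSpectralMeasure K) (x : K) : Measure Circle :=
  Measure.ofMeasurable (fun s _ => ENNReal.ofReal (inner ℂ x (F.toFun s x)).re)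
    (by
      have h := F.iUnion' (fun _ => ∅) (fun _ => MeasurableSet.empty)
        (fun _ _ _ => disjoint_bot_left) x
      have h0 : F.toFun ∅ x = 0 := (summable_const_iff _).1 h.summable
      simp [h0])
    (by
      intro f hf hd
      have h := ((F.iUnion' f hf hd x).mapL (innerSL ℂ x)).mapL Complex.reCLM
      simp only [innerSL_apply_apply, Complex.reCLM_apply] at h
      have hnn : ∀ i, 0 ≤ (inner ℂ x (F.toFun (f i) x)).re := fun i => by
        rw [F.inner_eq x (hf i), Complex.ofReal_re]
        positivity
      rw [← h.tsum_eq, ENNReal.ofReal_tsum_of_nonneg hnn h.summable])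

theorem scalarMeasure_apply (F : OrthogonalSpectralMeasure K) (x : K) {s : Set Circle}
    (hs : MeasurableSet s) :
    F.scalarMeasure x s = ENNReal.ofReal (inner ℂ x (F.toFun s x)).re :=
  Measure.ofMeasurable_apply s hs

/-- `F` is the orthogonal spectral measure of the unitary operator `U`, i.e. `U = ∫_𝕋 z dF(z)`,
in the weak sense `(U x, x) = ∫_𝕋 z d(F(z) x, x)` for all `x`. -/
def IsSpectralMeasureOf (F : OrthogonalSpectralMeasure K) (U : K ≃ₗᵢ[ℂ] K) : Prop :=
  ∀ x : K, inner ℂ x (U x) = ∫ z : Circle, (z : ℂ) ∂(F.scalarMeasure x)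

end OrthogonalSpectralMeasure

/-- `E` is a spectral measure of the isometric operator `A` in `H`: there are a Hilbert space
`K ⊇ H` (the inclusion being the isometry `ι`) and a unitary operator `U ⊇ A` in `K`, with
orthogonal spectral measure `F`, such that `E(δ) = P_H F(δ)|_H` for all Borel sets `δ`. -/
def IsSpectralMeasure {H : Type*} [NormedAddCommGroup H] [InnerProductSpace ℂ H] [CompleteSpace H]
    (A : H →ₗ.[ℂ] H) (E : Set Circle → (H →L[ℂ] H)) : Prop :=
  ∃ (K : Type v) (_ : NormedAddCommGroup K) (_ : InnerProductSpace ℂ K) (_ : CompleteSpace K)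
    (ι : H →ₗᵢ[ℂ] K) (U : K ≃ₗᵢ[ℂ] K) (F : OrthogonalSpectralMeasure K),
    F.IsSpectralMeasureOf U ∧ (∀ x : A.domain, U (ι x) = ι (A x)) ∧
      ∀ δ : Set Circle, MeasurableSet δ →
        E δ = (ContinuousLinearMap.adjoint ι.toContinuousLinearMap) ∘L (F.toFun δ) ∘L
          ι.toContinuousLinearMap

/-- The arc `δ_t = {e^{iτ} : 0 ≤ τ < t}`. -/
def arc (t : ℝ) : Set Circle := Circle.exp '' Ico 0 t

/-- The matrix measure `M_𝕋(δ) = ((E(δ) x_k, x_j)_H)_{k,j=0}^{N-1}`. -/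
def matrixMeasure (hT : (toeplitz S).PosSemidef)
    (E : Set Circle → (MomentSpace hT →L[ℂ] MomentSpace hT)) (δ : Set Circle) :
    Matrix (Fin N) (Fin N) ℂ :=
  Matrix.of fun k j => inner ℂ (momentVec hT (0, j)) (E δ (momentVec hT (0, k)))

/-- `E` is the spectral measure of `A` that corresponds to the solution `M`: it is a spectral
measure of `A`, and its spectral function `E_t = E(δ_t)` satisfies
`M(t) = ((E_t x_k, x_j)_H)_{k,j=0}^{N-1}` for `0 ≤ t < 2π`. -/
structure IsCorrespondingSpectralMeasure (hT : (toeplitz S).PosSemidef)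
    (M : ℝ → Matrix (Fin N) (Fin N) ℂ)
    (E : Set Circle → (MomentSpace hT →L[ℂ] MomentSpace hT)) : Prop where
  isSpectralMeasure : IsSpectralMeasure.{v} (shiftOperator hT) E
  eq_matrixMeasure : ∀ t : ℝ, 0 ≤ t → t < 2 * Real.pi → M t = matrixMeasure hT E (arc t)

end

end TruncatedMoment

namespace TruncatedMoment

namespace OrthogonalSpectralMeasure

variable {K : Type*} [NormedAddCommGroup K] [InnerProductSpace ℂ K] [CompleteSpace K]

/-! Only the implication from $M_{\mathbb T}(\Delta)=0$ to $\mathbf E(\Delta)=0$ has content. The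
compression $\mathbf E(\Delta)$ need not be a projection, so the argument runs in the dilation space
with the projection $F(\Delta)$. There each diagonal entry of $M_{\mathbb T}(\Delta)$ is
$\|F(\Delta)x_k\|^2$, so its vanishing gives $F(\Delta)x_k=0$ for $k<N$. Since $U\supseteq A$, one
has $x_{jN+k}=U^jx_k$, and $F(\Delta)$ commutes with $U$; hence $F(\Delta)$ kills every $x_n$, and
these span $H$.

The commutation (`IsSpectralMeasureOf.apply_comm`) has to be extracted from the weak identity
$(Ux,x)=\int z\,d(F(z)x,x)$: `scalarMeasure_add` and `inner_eq_zero` show that $U$ has no matrix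
coefficients between the range and the kernel of $F(\Delta)$. -/

theorem apply_comm (F : OrthogonalSpectralMeasure K) {s t : Set Circle} (hs : MeasurableSet s)
    (ht : MeasurableSet t) (x : K) : F.toFun s (F.toFun t x) = F.toFun t (F.toFun s x) := by
  have h : F.toFun s * F.toFun t = F.toFun t * F.toFun s := by
    rw [← F.inter' s t hs ht, ← F.inter' t s ht hs, inter_comm]
  exact congrArg (fun T : K →L[ℂ] K => T x) h

theorem apply_apply (F : OrthogonalSpectralMeasure K) {s : Set Circle} (hs : MeasurableSet s)
    (x : K) : F.toFun s (F.toFun s x) = F.toFun s x :=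
  congrArg (fun T : K →L[ℂ] K => T x) (F.isStarProjection' s hs).isIdempotentElem.eq

theorem inner_apply_left (F : OrthogonalSpectralMeasure K) {s : Set Circle}
    (hs : MeasurableSet s) (x y : K) : inner ℂ (F.toFun s x) y = inner ℂ x (F.toFun s y) := by
  have h := ContinuousLinearMap.adjoint_inner_left (F.toFun s) y x
  rwa [← ContinuousLinearMap.star_eq_adjoint,
    (F.isStarProjection' s hs).isSelfAdjoint.star_eq] at h

/-- Since $F(t)$ commutes with $F(s)$, it preserves the kernel of $F(s)$, which is orthogonal to the
range. -/
theorem inner_apply_eq_zero (F : OrthogonalSpectralMeasure K) {s t : Set Circle}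
    (hs : MeasurableSet s) (ht : MeasurableSet t) {a b : K} (ha : F.toFun s a = a)
    (hb : F.toFun s b = 0) : inner ℂ a (F.toFun t b) = 0 := by
  rw [← ha, F.inner_apply_left hs, F.apply_comm hs ht, hb, map_zero, inner_zero_right]

instance isFiniteMeasure_scalarMeasure (F : OrthogonalSpectralMeasure K) (x : K) :
    IsFiniteMeasure (F.scalarMeasure x) :=
  ⟨by rw [F.scalarMeasure_apply x MeasurableSet.univ]; exact ENNReal.ofReal_lt_top⟩

theorem scalarMeasure_add (F : OrthogonalSpectralMeasure K) {s : Set Circle}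
    (hs : MeasurableSet s) {a b : K} (ha : F.toFun s a = a) (hb : F.toFun s b = 0) :
    F.scalarMeasure (a + b) = F.scalarMeasure a + F.scalarMeasure b := by
  ext t ht
  have hab := F.inner_apply_eq_zero hs ht ha hb
  have hba : inner ℂ b (F.toFun t a) = 0 := by
    rw [← F.inner_apply_left ht, ← inner_conj_symm, hab, map_zero]
  have hnn : ∀ x : K, 0 ≤ (inner ℂ x (F.toFun t x)).re := fun x => by
    rw [F.inner_eq x ht, Complex.ofReal_re]
    positivity
  rw [Measure.add_apply, F.scalarMeasure_apply _ ht, F.scalarMeasure_apply _ ht,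
    F.scalarMeasure_apply _ ht, ← ENNReal.ofReal_add (hnn a) (hnn b), map_add, inner_add_left,
    inner_add_right, inner_add_right, hab, hba, add_zero, zero_add, Complex.add_re]

theorem integrable_coe_scalarMeasure (F : OrthogonalSpectralMeasure K) (x : K) :
    Integrable (fun z : Circle => (z : ℂ)) (F.scalarMeasure x) :=
  Integrable.of_bound (C := 1)
    (show Continuous fun z : Circle => (z : ℂ) by fun_prop).aestronglyMeasurable
    (ae_of_all _ fun z => (Circle.norm_coe z).le)

namespace IsSpectralMeasureOf

variable {F : OrthogonalSpectralMeasure K} {U : K ≃ₗᵢ[ℂ] K}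

/-- The scalar measures of $a$ and $b$ add up to that of $a+b$, so $(Ux,x)$ is additive on this pair
and its cross terms cancel. -/
theorem inner_add_inner_eq_zero (h : F.IsSpectralMeasureOf U) {s : Set Circle}
    (hs : MeasurableSet s) {a b : K} (ha : F.toFun s a = a) (hb : F.toFun s b = 0) :
    inner ℂ a (U b) + inner ℂ b (U a) = 0 := by
  have hab := h (a + b)
  rw [F.scalarMeasure_add hs ha hb, integral_add_measure (F.integrable_coe_scalarMeasure a)
    (F.integrable_coe_scalarMeasure b), ← h a, ← h b, map_add, inner_add_left, inner_add_right,
    inner_add_right] at hab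
  linear_combination hab

theorem inner_eq_zero (h : F.IsSpectralMeasureOf U) {s : Set Circle} (hs : MeasurableSet s)
    {a b : K} (ha : F.toFun s a = a) (hb : F.toFun s b = 0) :
    inner ℂ a (U b) = 0 ∧ inner ℂ b (U a) = 0 := by
  have h1 := h.inner_add_inner_eq_zero hs ha hb
  -- Polarisation: replacing $b$ by $ib$ multiplies the two cross terms by $i$ and $-i$, so their
  -- difference vanishes as well as their sum.
  have h2 := h.inner_add_inner_eq_zero hs (b := Complex.I • b) ha (by rw [map_smul, hb, smul_zero])
  rw [map_smul, inner_smul_right, inner_smul_left, Complex.conj_I] at h2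
  have h3 : inner ℂ a (U b) - inner ℂ b (U a) = 0 := by
    refine (mul_eq_zero.1 ?_).resolve_left Complex.I_ne_zero
    linear_combination h2
  exact ⟨by linear_combination (h1 + h3) / 2, by linear_combination (h1 - h3) / 2⟩

/-- A unitary operator commutes with its spectral measure. -/
theorem apply_comm (h : F.IsSpectralMeasureOf U) {s : Set Circle} (hs : MeasurableSet s) (x : K) :
    F.toFun s (U x) = U (F.toFun s x) := by
  have hb : F.toFun s (x - F.toFun s x) = 0 := by rw [map_sub, F.apply_apply hs, sub_self]
  -- $U$ preserves the kernel of $F(s)$: the range component of $Ub$ is orthogonal to $Ub$, hence to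
  -- itself.
  have h1 : F.toFun s (U (x - F.toFun s x)) = 0 := by
    rw [← inner_self_eq_zero (𝕜 := ℂ), ← F.inner_apply_left hs, F.apply_apply hs]
    exact (h.inner_eq_zero hs (F.apply_apply hs _) hb).1
  -- $U$ preserves the range: the kernel component $y-F(s)y$ is orthogonal to both $y$ and $F(s)y$,
  -- hence to itself.
  have h2 : U (F.toFun s x) - F.toFun s (U (F.toFun s x)) = 0 := by
    set y := U (F.toFun s x) with hy
    have hy0 : F.toFun s (y - F.toFun s y) = 0 := by rw [map_sub, F.apply_apply hs, sub_self]
    have h3 := (h.inner_eq_zero hs (F.apply_apply hs x) hy0).2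
    rw [← hy] at h3
    have h4 : inner ℂ (y - F.toFun s y) (F.toFun s y) = 0 := by
      rw [← F.inner_apply_left hs, hy0, inner_zero_left]
    rw [← inner_self_eq_zero (𝕜 := ℂ), inner_sub_right, h3, h4, sub_zero]
  rw [map_sub, map_sub, sub_eq_zero] at h1
  rw [h1, ← sub_eq_zero.1 h2]

end IsSpectralMeasureOf

end OrthogonalSpectralMeasure

variable {N d : ℕ} {S : Fin (d + 1) → Matrix (Fin N) (Fin N) ℂ}

theorem momentVec_mem_domain (hT : (toeplitz S).PosSemidef) (j : Fin d) (k : Fin N) :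
    momentVec hT (j.castSucc, k) ∈ (shiftOperator hT).domain := by
  rw [shiftOperator_domain]
  exact Submodule.subset_span ⟨(j, k), rfl⟩

theorem shiftOperator_momentVec (hT : (toeplitz S).PosSemidef) (j : Fin d) (k : Fin N) :
    shiftOperator hT ⟨momentVec hT (j.castSucc, k), momentVec_mem_domain hT j k⟩ =
      momentVec hT (j.succ, k) := by
  classical
  rw [shiftOperator_apply hT (Pi.single (j, k) 1)] <;> simp [Pi.single_apply, ite_smul]

theorem eq_zero_of_matrixMeasure_eq_zero (hT : (toeplitz S).PosSemidef)
    {E : Set Circle → (MomentSpace hT →L[ℂ] MomentSpace hT)}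
    (hE : IsSpectralMeasure.{v} (shiftOperator hT) E) {Δ : Set Circle} (hΔ : MeasurableSet Δ)
    (h : matrixMeasure hT E Δ = 0) : E Δ = 0 := by
  obtain ⟨K, _, _, _, ι, U, F, hF, hU, hE⟩ := hE
  have key : ∀ (j : Fin (d + 1)) (k : Fin N), F.toFun Δ (ι (momentVec hT (j, k))) = 0 := by
    intro j k
    induction j using Fin.induction with
    | zero =>
      -- The diagonal entries suffice, because $F(\Delta)$ is a projection.
      have h0 : inner ℂ (momentVec hT (0, k)) (E Δ (momentVec hT (0, k))) = 0 :=
        congrFun (congrFun h k) k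
      rw [hE Δ hΔ, ContinuousLinearMap.comp_apply, ContinuousLinearMap.adjoint_inner_right] at h0
      change inner ℂ (ι (momentVec hT (0, k))) (F.toFun Δ (ι (momentVec hT (0, k)))) = 0 at h0
      rw [F.inner_eq _ hΔ] at h0
      exact norm_eq_zero.1 (pow_eq_zero_iff two_ne_zero |>.1 (Complex.ofReal_eq_zero.1 h0))
    | succ j ih =>
      -- $x_{(j+1)N+k}=Ax_{jN+k}=Ux_{jN+k}$ inside $K$, and $F(\Delta)$ passes through $U$.
      rw [← shiftOperator_momentVec, ← hU, hF.apply_comm hΔ, ih, map_zero]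
  have key' : ∀ x : MomentSpace hT, F.toFun Δ (ι x) = 0 := by
    intro x
    obtain ⟨u, rfl⟩ : ∃ u, cls hT u = x := SeparationQuotient.surjective_mk x
    rw [cls_eq_sum, map_sum, map_sum]
    exact Finset.sum_eq_zero fun p _ => by rw [map_smul, map_smul, key, smul_zero]
  ext x
  rw [hE Δ hΔ, ContinuousLinearMap.comp_apply]
  change ContinuousLinearMap.adjoint ι.toContinuousLinearMap (F.toFun Δ (ι x)) = 0
  rw [key', map_zero]

end TruncatedMoment

theorem mainTheorem5 (N d : ℕ) (hN : 1 ≤ N) (hd : 1 ≤ d)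
    (S : Fin (d + 1) → Matrix (Fin N) (Fin N) ℂ)
    (hT : (TruncatedMoment.toeplitz S).PosSemidef)
    (hind : TruncatedMoment.IsIndeterminate S)
    (M : ℝ → Matrix (Fin N) (Fin N) ℂ) (hM : TruncatedMoment.IsSolution S M)
    (E : Set Circle →
      (TruncatedMoment.MomentSpace hT →L[ℂ] TruncatedMoment.MomentSpace hT))
    (hE : TruncatedMoment.IsCorrespondingSpectralMeasure.{v} hT M E)
    (Δ : Set Circle) (hΔ : MeasurableSet Δ) :
    TruncatedMoment.matrixMeasure hT E Δ = 0 ↔ E Δ = 0 := by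
  refine ⟨TruncatedMoment.eq_zero_of_matrixMeasure_eq_zero hT hE.isSpectralMeasure hΔ, fun h => ?_⟩
  ext k j
  simp [TruncatedMoment.matrixMeasure, h]
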